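/- Let $G=(V,E)$ be a finite simple graph and let $p\colon V\to\mathbb{R}^2$, $v_i\mapsto p_i$, be an injective map. Write $G(p)\subset\mathbb{R}^2$ for the union of the points $p_i$ $(v_i\in V)$ and of the closed segments $p_ip_j$ $(v_iv_j\in E)$. The edges may cross, and vertices may lie on other edges, but no two different edges overlap along a non-degenerate segment (that is, any two different edges $p_ip_j$, $p_kp_l$ have at most one point in common). Let $\omega$ be a self-stress, i.e. real numbers $\omega_{ij}=\omega_{ji}$ with $\omega_{ij}=0$ if $v_iv_j\notin E$, and $\sum_{j\ne i}\omega_{ij}(p_i-p_j)=0$ for every $i$. A chamber is a connected component of $\mathbb{R}^2\setminus G(p)$. Two different chambers $C_1,C_2$ are neighbours along the edge $p_ip_j$ if their boundaries share a non-empty open sub-segment of $p_ip_j$; then $\mathbf{n}_{12}$ denotes the unit normal vector to $p_i-p_j$ pointing from $C_1$ to $C_2$ across that sub-segment. For a vector $v=(v_1,v_2)$ let $dv=v_1\,dx+v_2\,dy$. Then there exists a unique differential lifting, i.e. a unique map $l$ from the set of chambers to the constant $1$-forms on $\mathbb{R}^2$ that vanishes on the unbounded chamber and satisfies, whenever $C_1$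 and $C_2$ are neighbours along an edge $p_ip_j$, $$l(C_2)-l(C_1)=\operatorname{sign}\bigl(\det(\mathbf{n}_{12},\,p_i-p_j)\bigr)\,\omega_{ij}\,d(p_i-p_j).$$ -/

import Mathlib

open Set Filter Topology

noncomputable section

/-- The Euclidean plane. -/
abbrev Plane : Type := EuclideanSpace ℝ (Fin 2)

/-- Constant differential 1-forms on the plane: a constant 1-form is given by its common value,
a covector, at all points. -/
abbrev ConstOneForm : Type := Plane →L[ℝ] ℝ

/-- The constant 1-form `dv = v₁ dx + v₂ dy` identified with the vector `v = (v₁, v₂)`. -/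
def formOf (v : Plane) : ConstOneForm :=
  v 0 • (EuclideanSpace.proj 0 : Plane →L[ℝ] ℝ) + v 1 • (EuclideanSpace.proj 1 : Plane →L[ℝ] ℝ)

/-- The determinant of the matrix with columns `u` and `v`. -/
def planeDet (u v : Plane) : ℝ :=
  Matrix.det !![u 0, v 0; u 1, v 1]

/-- A framework in the plane: a simple graph with an injective placement of its vertices. -/
structure PlaneFramework (V : Type*) where
  graph : SimpleGraph V
  p : V → Plane
  injective_p : Function.Injective p

namespace PlaneFramework

variable {V : Type*} (F : PlaneFramework V)

/-- The point set `G(p)`: all vertices and all (straight, closed) edges. -/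
def carrier : Set Plane :=
  range F.p ∪ {x | ∃ i j, F.graph.Adj i j ∧ x ∈ segment ℝ (F.p i) (F.p j)}

/-- Two different edges never overlap along a segment, that is, they have at most one point
in common. Crossings, and vertices in the interior of edges, are allowed. -/
def EdgesDoNotOverlap : Prop :=
  ∀ i j k l, F.graph.Adj i j → F.graph.Adj k l → s(i, j) ≠ s(k, l) →
    (segment ℝ (F.p i) (F.p j) ∩ segment ℝ (F.p k) (F.p l)).Subsingleton

/-- `ω` is a self-stress: symmetric, zero on non-edges, and in equilibrium at every vertex. -/
structure IsSelfStress [Fintype V] (ω : V → V → ℝ) : Prop where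
  symm : ∀ i j, ω i j = ω j i
  eq_zero_of_not_adj : ∀ i j, ¬ F.graph.Adj i j → ω i j = 0
  equilibrium : ∀ i, ∑ j, ω i j • (F.p i - F.p j) = 0

/-- The chambers: the connected components of the complement of `G(p)` in the plane. -/
abbrev Chamber : Type := ConnectedComponents ↥(F.carrierᶜ)

variable {F}

/-- A chamber as a set of points of the plane. -/
def Chamber.region (C : F.Chamber) : Set Plane :=
  Subtype.val '' ((ConnectedComponents.mk : ↥(F.carrierᶜ) → F.Chamber) ⁻¹' {C})

/-- The different chambers `C₁`, `C₂` are neighbours along the edge `p i p j`, sharing its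
non-empty open sub-segment between `a` and `b`. -/
structure AreNeighboursAlong (C₁ C₂ : F.Chamber) (i j : V) (a b : Plane) : Prop where
  ne : C₁ ≠ C₂
  adj : F.graph.Adj i j
  endpoints_ne : a ≠ b
  subset_edge : openSegment ℝ a b ⊆ openSegment ℝ (F.p i) (F.p j)
  subset_left : openSegment ℝ a b ⊆ frontier (Chamber.region C₁)
  subset_right : openSegment ℝ a b ⊆ frontier (Chamber.region C₂)

/-- `n` is the unit normal vector to `p i - p j` that points from `C₁` to `C₂` across the
sub-segment between `a` and `b`: near each of its points, `C₁` lies on the side of `-n` and `C₂`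
on the side of `n`. -/
structure IsUnitNormalFromTo (n : Plane) (C₁ C₂ : F.Chamber) (i j : V) (a b : Plane) : Prop where
  norm_eq_one : ‖n‖ = 1
  orthogonal : inner ℝ n (F.p i - F.p j) = 0
  crosses : ∀ x ∈ openSegment ℝ a b, ∀ᶠ t : ℝ in 𝓝[>] 0,
    x - t • n ∈ Chamber.region C₁ ∧ x + t • n ∈ Chamber.region C₂

variable (F)

/-- The neighbouring condition for `α₁`, `α₂` across the edge `p i p j`, with unit normal `n`. -/
def NeighbouringCondition (ω : V → V → ℝ) (i j : V) (n : Plane) (α₁ α₂ : ConstOneForm) : Prop :=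
  α₂ - α₁ = (Real.sign (planeDet n (F.p i - F.p j)) * ω i j) • formOf (F.p i - F.p j)

/-- `l` is a differential lifting: it satisfies the neighbouring condition for all neighbouring
chambers and vanishes on the unbounded chamber. -/
structure IsDifferentialLifting (ω : V → V → ℝ) (l : F.Chamber → ConstOneForm) : Prop where
  neighbouring : ∀ (C₁ C₂ : F.Chamber) (i j : V) (a b n : Plane),
    AreNeighboursAlong C₁ C₂ i j a b → IsUnitNormalFromTo n C₁ C₂ i j a b →
      F.NeighbouringCondition ω i j n (l C₁) (l C₂)
  unbounded : ∀ C : F.Chamber, ¬ Bornology.IsBounded (Chamber.region C) → l C = 0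

end PlaneFramework

end

/-! Existence comes from an explicit formula. Let θ_ij(y) be the signed angle under which the edge
p_i p_j is seen from y, and attach to a chamber the form of (4π)⁻¹ ∑_ij ω_ij θ_ij(y) (p_i - p_j),
for any y in it. When y moves a little off the framework, θ_ij changes by a term depending only on
p_j minus one depending only on p_i. Grouped by vertex, the changes cancel by equilibrium, so the
sum is constant on each chamber (`eventually_stressAngleSum_eq`). Crossing an edge makes its angle
jump by ±2π in each of its two orientations, which explains the factor 4π
(`tendsto_stressAngleSum_jump`). Far away all angles tend to 0, so the sum vanishes on unbounded
chambers.

Uniqueness: the difference of two liftings takes equal values on neighbours. The plane minus the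
finitely many vertices and crossings is connected, and near each remaining point at most two
chambers meet, as neighbours along one edge. Hence the difference is constant
(`eq_of_forall_neighbours`), and it is zero on an unbounded chamber. -/

noncomputable section

/-! ### View angles: continuity, decay at infinity, jump across the segment. -/

/-- The plane as the complex line. -/
def toComplex : Plane ≃ₗᵢ[ℝ] ℂ := Complex.orthonormalBasisOneI.repr.symm

lemma toComplex_re (v : Plane) : (toComplex v).re = v 0 := by
  simp [toComplex]

lemma toComplex_im (v : Plane) : (toComplex v).im = v 1 := by
  simp [toComplex]

lemma continuous_toComplex : Continuous toComplex := toComplex.continuous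

/-- The signed angle in `(-π, π]` under which the segment from `p` to `q` is seen from `y`. -/
def viewAngle (p q y : Plane) : ℝ := Complex.arg (toComplex (q - y) / toComplex (p - y))

lemma toComplex_sub_ne_zero {p y : Plane} (h : y ≠ p) : toComplex (p - y) ≠ 0 := by
  simpa [sub_eq_zero] using h.symm

/-- A ratio w ≤ 0 would mean q - y = w (p - y), which exhibits y as the convex combination (-w p +
q) / (1 - w). So the branch cut of `arg` is met only on the segment. -/
lemma ratio_mem_slitPlane {p q y : Plane} (h : y ∉ segment ℝ p q) :
    toComplex (q - y) / toComplex (p - y) ∈ Complex.slitPlane := by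
  by_contra hs
  have hp : y ≠ p := by rintro rfl; exact h (left_mem_segment ℝ _ _)
  have hp' := toComplex_sub_ne_zero hp
  rw [Complex.mem_slitPlane_iff_not_le_zero, not_not] at hs
  set w := toComplex (q - y) / toComplex (p - y) with hw
  have hre : w.re ≤ 0 := (Complex.le_def.1 hs).1
  have him : w.im = 0 := (Complex.le_def.1 hs).2
  have hwr : w = (w.re : ℂ) := by apply Complex.ext <;> simp [him]
  have h1 : toComplex (q - y) = toComplex (w.re • (p - y)) := by
    rw [map_smul, Complex.real_smul, ← hwr, hw]; field_simp
  have h2 : q - y = w.re • (p - y) := toComplex.injective h1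
  have hpos : (0 : ℝ) < 1 - w.re := by linarith
  apply h
  refine ⟨-w.re / (1 - w.re), 1 / (1 - w.re), div_nonneg (by linarith) hpos.le, by positivity,
    by field_simp; ring, ?_⟩
  have h3 : q = y + w.re • (p - y) := by rw [← h2]; abel
  rw [h3]
  ext k
  simp
  field_simp
  ring

lemma continuousAt_ratio {p q y : Plane} (h : y ≠ p) :
    ContinuousAt (fun y => toComplex (q - y) / toComplex (p - y)) y := by
  have := continuous_toComplex
  exact ContinuousAt.div (by fun_prop) (by fun_prop) (toComplex_sub_ne_zero h)

lemma continuousAt_viewAngle {p q y : Plane} (h : y ∉ segment ℝ p q) :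
    ContinuousAt (viewAngle p q) y := by
  have hp : y ≠ p := by rintro rfl; exact h (left_mem_segment ℝ _ _)
  exact ContinuousAt.comp (g := Complex.arg) (Complex.continuousAt_arg (ratio_mem_slitPlane h))
    (continuousAt_ratio hp)

/-- The signed angle by which the direction towards `p` turns when the viewpoint moves from `x`
to `y`. -/
def turnAngle (p x y : Plane) : ℝ := Complex.arg (toComplex (p - y) / toComplex (p - x))

lemma turnAngle_self (p x : Plane) : turnAngle p x x = 0 := by
  unfold turnAngle
  by_cases h : toComplex (p - x) = 0 <;> simp [h]

lemma continuousAt_turnAngle {p x : Plane} (h : x ≠ p) : ContinuousAt (turnAngle p x) x := by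
  have := continuous_toComplex
  have h1 := toComplex_sub_ne_zero h
  have hc : ContinuousAt (fun y => toComplex (p - y) / toComplex (p - x)) x := by fun_prop
  refine ContinuousAt.comp (g := Complex.arg) (Complex.continuousAt_arg ?_) hc
  simp only [div_self h1]
  exact Complex.one_mem_slitPlane

/-- Away from the segment, the view angle varies by the difference of the turning angles of the
end points. -/
lemma eventually_viewAngle_sub {p q x : Plane} (h : x ∉ segment ℝ p q) :
    ∀ᶠ y in 𝓝 x, viewAngle p q y - viewAngle p q x = turnAngle q x y - turnAngle p x y := by
  have hp : x ≠ p := by rintro rfl; exact h (left_mem_segment ℝ _ _)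
  have hq : x ≠ q := by rintro rfl; exact h (right_mem_segment ℝ _ _)
  -- The defect `f` is a multiple of 2π, is continuous at `x` and vanishes there; hence it is zero
  -- nearby.
  set f : Plane → ℝ := fun y =>
    viewAngle p q y - viewAngle p q x - (turnAngle q x y - turnAngle p x y) with hf
  have hc : ContinuousAt f x :=
    ((continuousAt_viewAngle h).sub continuousAt_const).sub
      ((continuousAt_turnAngle hq).sub (continuousAt_turnAngle hp))
  have h0 : f x = 0 := by simp [hf, turnAngle_self]
  have hsmall : ∀ᶠ y in 𝓝 x, |f y| < 2 * Real.pi := by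
    have : Tendsto (fun y => |f y|) (𝓝 x) (𝓝 0) := by
      have := hc.tendsto.abs; rwa [h0, abs_zero] at this
    exact this.eventually_lt_const (by positivity)
  filter_upwards [hsmall, isOpen_ne.mem_nhds hp, isOpen_ne.mem_nhds hq] with y hy hyp hyq
  have e1 := toComplex_sub_ne_zero hp
  have e2 := toComplex_sub_ne_zero hq
  have e3 := toComplex_sub_ne_zero hyp
  have e4 := toComplex_sub_ne_zero hyq
  have hang : ((f y : ℝ) : Real.Angle) = ((0 : ℝ) : Real.Angle) := by
    simp only [hf, viewAngle, turnAngle, Real.Angle.coe_sub, Complex.arg_div_coe_angle e4 e3,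
      Complex.arg_div_coe_angle e2 e1, Complex.arg_div_coe_angle e4 e2,
      Complex.arg_div_coe_angle e3 e1, Real.Angle.coe_zero]
    abel
  obtain ⟨k, hk⟩ := Real.Angle.angle_eq_iff_two_pi_dvd_sub.1 hang
  rw [sub_zero] at hk
  have hk0 : k = 0 := by
    rw [hk, abs_mul, abs_of_pos (by positivity : (0 : ℝ) < 2 * Real.pi)] at hy
    have hy1 : |(k : ℝ)| < 1 := by
      by_contra hcon
      push Not at hcon
      nlinarith [Real.pi_pos]
    have : |k| < 1 := by exact_mod_cast hy1
    simpa using this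
  rw [hk0] at hk
  simp only [Int.cast_zero, mul_zero] at hk
  exact sub_eq_zero.1 hk

/-- The ratio equals 1 + (q - p) / (p - y), which tends to 1, where `arg` is continuous with value
0. -/
lemma tendsto_viewAngle_cobounded (p q : Plane) :
    Tendsto (viewAngle p q) (Bornology.cobounded Plane) (𝓝 0) := by
  have h1 : Tendsto (fun y : Plane => toComplex (p - y)) (Bornology.cobounded Plane)
      (Bornology.cobounded ℂ) := by
    rw [← tendsto_norm_atTop_iff_cobounded]
    simp only [LinearIsometryEquiv.norm_map]
    refine tendsto_atTop_mono (f := fun y => ‖y‖ - ‖p‖) (fun y => ?_)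
      (tendsto_atTop_add_const_right _ _ tendsto_norm_cobounded_atTop)
    rw [norm_sub_rev]; exact norm_sub_norm_le y p
  have h2 : Tendsto (fun y : Plane => 1 + toComplex (q - p) * (toComplex (p - y))⁻¹)
      (Bornology.cobounded Plane) (𝓝 1) := by
    simpa using ((tendsto_inv₀_cobounded.comp h1).const_mul (toComplex (q - p))).const_add 1
  have h3 : Tendsto (fun y : Plane => toComplex (q - y) / toComplex (p - y))
      (Bornology.cobounded Plane) (𝓝 1) := by
    refine h2.congr' ?_
    have hne : ∀ᶠ y in Bornology.cobounded Plane, y ≠ p :=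
      Bornology.isBounded_def.1 (Bornology.isBounded_singleton (x := p))
    filter_upwards [hne] with y hy
    have e := toComplex_sub_ne_zero hy
    have : toComplex (q - y) = toComplex (q - p) + toComplex (p - y) := by
      rw [← map_add]; congr 1; abel
    rw [this]; field_simp; ring
  have := (Complex.continuousAt_arg Complex.one_mem_slitPlane).tendsto.comp h3
  rw [Complex.arg_one] at this
  exact this

/-- Up to the squared modulus, the imaginary part is det(p - y, q - y) at y = x + t n. The part free
of t vanishes because x, p, q are collinear. The sign tells from which side `arg` approaches its
cut. -/
lemma ratio_im_sign {p q x n : Plane} (hx : x ∈ openSegment ℝ p q) (t : ℝ) :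
    (toComplex (q - (x + t • n)) / toComplex (p - (x + t • n))).im =
      t * planeDet n (p - q) / Complex.normSq (toComplex (p - (x + t • n))) := by
  obtain ⟨a, b, ha, hb, hab, rfl⟩ := hx
  obtain rfl : a = 1 - b := by linarith
  rw [Complex.div_im, ← sub_div]
  congr 1
  simp only [toComplex_re, toComplex_im, planeDet, Matrix.det_fin_two]
  simp
  ring

lemma ratio_re_neg {p q x : Plane} (hpq : p ≠ q) (hx : x ∈ openSegment ℝ p q) :
    (toComplex (q - x) / toComplex (p - x)).re < 0 := by
  obtain ⟨a, b, ha, hb, hab, rfl⟩ := hx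
  have h1 : q - (a • p + b • q) = a • (q - p) := by
    obtain rfl : b = 1 - a := by linarith
    module
  have h2 : p - (a • p + b • q) = (-b) • (q - p) := by
    obtain rfl : b = 1 - a := by linarith
    module
  have h3 : toComplex (q - p) ≠ 0 := toComplex_sub_ne_zero hpq
  rw [h1, h2, map_smul, map_smul, Complex.real_smul, Complex.real_smul,
    mul_div_mul_right _ _ h3, ← Complex.ofReal_div, Complex.ofReal_re]
  exact div_neg_of_pos_of_neg ha (by linarith)

/-- One-sided limits of the view angle at an interior point of the segment. -/
lemma tendsto_viewAngle_of_pos {p q x n : Plane} (hpq : p ≠ q) (hx : x ∈ openSegment ℝ p q)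
    (hn : 0 < planeDet n (p - q)) :
    Tendsto (fun t : ℝ => viewAngle p q (x + t • n)) (𝓝[>] 0) (𝓝 Real.pi) ∧
      Tendsto (fun t : ℝ => viewAngle p q (x - t • n)) (𝓝[>] 0) (𝓝 (-Real.pi)) := by
  have hxp : x ≠ p := by
    rintro rfl
    exact hpq ((left_mem_openSegment_iff).1 hx)
  have hre := ratio_re_neg hpq hx
  have him : (toComplex (q - x) / toComplex (p - x)).im = 0 := by
    simpa using ratio_im_sign (n := n) hx 0
  have hR : Tendsto (fun y => toComplex (q - y) / toComplex (p - y)) (𝓝 x)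
      (𝓝 (toComplex (q - x) / toComplex (p - x))) := continuousAt_ratio hxp
  have hplus : Tendsto (fun t : ℝ => x + t • n) (𝓝[>] 0) (𝓝 x) := by
    have : ContinuousAt (fun t : ℝ => x + t • n) 0 := by fun_prop
    simpa using this.tendsto.mono_left nhdsWithin_le_nhds
  have hminus : Tendsto (fun t : ℝ => x - t • n) (𝓝[>] 0) (𝓝 x) := by
    have : ContinuousAt (fun t : ℝ => x - t • n) 0 := by fun_prop
    simpa using this.tendsto.mono_left nhdsWithin_le_nhds
  constructor
  · refine (Complex.tendsto_arg_nhdsWithin_im_nonneg_of_re_neg_of_im_zero hre him).comp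
      (tendsto_nhdsWithin_iff.2 ⟨hR.comp hplus, ?_⟩)
    filter_upwards [self_mem_nhdsWithin] with t ht
    rw [ratio_im_sign hx]
    exact div_nonneg (mul_pos ht hn).le (Complex.normSq_nonneg _)
  · refine (Complex.tendsto_arg_nhdsWithin_im_neg_of_re_neg_of_im_zero hre him).comp
      (tendsto_nhdsWithin_iff.2 ⟨hR.comp hminus, ?_⟩)
    -- On the cut itself `arg` is π, so the limit -π needs a strictly negative imaginary part, hence
    -- a non-zero denominator.
    have hne : ∀ᶠ t : ℝ in 𝓝[>] 0, x - t • n ≠ p := hminus.eventually_ne hxp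
    filter_upwards [self_mem_nhdsWithin, hne] with t ht hne
    have e := Complex.normSq_pos.2 (toComplex_sub_ne_zero hne)
    change (toComplex (q - (x - t • n)) / toComplex (p - (x - t • n))).im < 0
    have := ratio_im_sign (n := n) hx (-t)
    rw [neg_smul, ← sub_eq_add_neg] at this
    rw [this]
    refine div_neg_of_neg_of_pos ?_ e
    have : 0 < t := ht
    nlinarith

lemma planeDet_neg_left (u v : Plane) : planeDet (-u) v = -planeDet u v := by
  simp [planeDet, Matrix.det_fin_two]; ring

/-- The view angle jumps by `±2π` across the segment. -/
lemma tendsto_viewAngle_jump {p q x n : Plane} (hpq : p ≠ q) (hx : x ∈ openSegment ℝ p q)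
    (hn : planeDet n (p - q) ≠ 0) :
    Tendsto (fun t : ℝ => viewAngle p q (x + t • n) - viewAngle p q (x - t • n)) (𝓝[>] 0)
      (𝓝 (Real.sign (planeDet n (p - q)) * (2 * Real.pi))) := by
  rcases hn.lt_or_gt with h | h
  · have h' : 0 < planeDet (-n) (p - q) := by rw [planeDet_neg_left]; linarith
    obtain ⟨h1, h2⟩ := tendsto_viewAngle_of_pos hpq hx h'
    rw [Real.sign_of_neg h]
    convert h2.sub h1 using 2
    · simp [sub_eq_add_neg]
    · ring
  · obtain ⟨h1, h2⟩ := tendsto_viewAngle_of_pos hpq hx h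
    rw [Real.sign_of_pos h]
    convert h1.sub h2 using 2
    ring

/-! ### Crossings and chambers of a framework. -/

namespace PlaneFramework

variable {V : Type*} (F : PlaneFramework V)

lemma vertex_mem_carrier (i : V) : F.p i ∈ F.carrier := Or.inl (mem_range_self i)

lemma edge_subset_carrier {i j : V} (h : F.graph.Adj i j) :
    segment ℝ (F.p i) (F.p j) ⊆ F.carrier := fun _ hx => Or.inr ⟨i, j, h, hx⟩

/-- Vertices together with the common points of two different edges. -/
def crossings : Set Plane :=
  range F.p ∪ {x | ∃ i j k l, F.graph.Adj i j ∧ F.graph.Adj k l ∧ s(i, j) ≠ s(k, l) ∧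
    x ∈ segment ℝ (F.p i) (F.p j) ∧ x ∈ segment ℝ (F.p k) (F.p l)}

lemma carrier_eq_union : F.carrier =
    range F.p ∪ ⋃ e ∈ {e : V × V | F.graph.Adj e.1 e.2}, segment ℝ (F.p e.1) (F.p e.2) := by
  ext x
  simp [carrier]

variable {F}

/-- The non-overlap assumption enters the argument through this finiteness: each pair of different
edges contributes at most one point. -/
lemma finite_crossings [Finite V] (hF : F.EdgesDoNotOverlap) : F.crossings.Finite := by
  refine (finite_range _).union ?_
  have : {x | ∃ i j k l, F.graph.Adj i j ∧ F.graph.Adj k l ∧ s(i, j) ≠ s(k, l) ∧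
      x ∈ segment ℝ (F.p i) (F.p j) ∧ x ∈ segment ℝ (F.p k) (F.p l)} ⊆
      ⋃ e ∈ {e : (V × V) × (V × V) | F.graph.Adj e.1.1 e.1.2 ∧ F.graph.Adj e.2.1 e.2.2 ∧
        s(e.1.1, e.1.2) ≠ s(e.2.1, e.2.2)},
        segment ℝ (F.p e.1.1) (F.p e.1.2) ∩ segment ℝ (F.p e.2.1) (F.p e.2.2) := by
    rintro x ⟨i, j, k, l, h1, h2, h3, h4, h5⟩
    simp only [mem_iUnion]
    exact ⟨((i, j), (k, l)), ⟨h1, h2, h3⟩, h4, h5⟩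
  refine Finite.subset (Finite.biUnion (toFinite _) ?_) this
  rintro e ⟨h1, h2, h3⟩
  exact (hF _ _ _ _ h1 h2 h3).finite

lemma isCompact_plane_segment (x y : Plane) : IsCompact (segment ℝ x y) := by
  rw [segment_eq_image]
  exact isCompact_Icc.image (by fun_prop)

variable (F) in
lemma isCompact_carrier [Finite V] : IsCompact F.carrier := by
  rw [carrier_eq_union]
  exact (finite_range _).isCompact.union
    ((toFinite _).isCompact_biUnion fun _ _ => isCompact_plane_segment _ _)

lemma mem_openSegment_of_notMem_crossings {i j : V} {x : Plane}
    (hx : x ∈ segment ℝ (F.p i) (F.p j)) (hS : x ∉ F.crossings) :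
    x ∈ openSegment ℝ (F.p i) (F.p j) :=
  mem_openSegment_of_ne_left_right (fun h => hS (Or.inl ⟨i, h⟩)) (fun h => hS (Or.inl ⟨j, h⟩)) hx

lemma Chamber.mem_region {C : F.Chamber} {x : Plane} :
    x ∈ C.region ↔ ∃ h : x ∈ F.carrierᶜ, ConnectedComponents.mk (⟨x, h⟩ : ↥(F.carrierᶜ)) = C := by
  constructor
  · rintro ⟨y, hy, rfl⟩; exact ⟨y.2, hy⟩
  · rintro ⟨h, hC⟩; exact ⟨⟨x, h⟩, hC, rfl⟩

lemma Chamber.region_subset (C : F.Chamber) : C.region ⊆ F.carrierᶜ :=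
  fun _ hx => (Chamber.mem_region.1 hx).1

lemma Chamber.region_nonempty (C : F.Chamber) : C.region.Nonempty := by
  obtain ⟨x, rfl⟩ := ConnectedComponents.surjective_coe C
  exact ⟨x, x, rfl, rfl⟩

/-- A preconnected set in the complement of the framework lies in the chamber of any of its
points. -/
lemma Chamber.subset_region_of_isPreconnected {C : F.Chamber} {s : Set Plane}
    (hs : IsPreconnected s) (hsub : s ⊆ F.carrierᶜ) {x : Plane} (hx : x ∈ s) (hxC : x ∈ C.region) :
    s ⊆ C.region := by
  intro y hy
  obtain ⟨h, rfl⟩ := Chamber.mem_region.1 hxC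
  refine Chamber.mem_region.2 ⟨hsub hy, ?_⟩
  rw [ConnectedComponents.coe_eq_coe']
  have hpre : IsPreconnected ((Subtype.val : ↥(F.carrierᶜ) → Plane) ⁻¹' s) := by
    rw [← Topology.IsInducing.subtypeVal.isPreconnected_image, Subtype.image_preimage_coe,
      inter_eq_right.2 hsub]
    exact hs
  exact hpre.subset_connectedComponent (x := ⟨x, h⟩) hx
    (show (⟨y, hsub hy⟩ : ↥(F.carrierᶜ)) ∈ _ from hy)

lemma Chamber.exists_mem_region {x : Plane} (hx : x ∈ F.carrierᶜ) :
    ∃ C : F.Chamber, x ∈ C.region :=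
  ⟨ConnectedComponents.mk ⟨x, hx⟩, Chamber.mem_region.2 ⟨hx, rfl⟩⟩

lemma Chamber.eq_of_mem_region {C D : F.Chamber} {x : Plane} (hC : x ∈ C.region)
    (hD : x ∈ D.region) : C = D := by
  obtain ⟨h, rfl⟩ := Chamber.mem_region.1 hC
  obtain ⟨_, rfl⟩ := Chamber.mem_region.1 hD
  rfl

/-! ### The stress-weighted angle sum. -/

section Stress

variable [Fintype V]

variable (F) in
/-- The stress-weighted sum of the edge vectors and the angles under which the edges are seen. -/
def stressAngleSum (ω : V → V → ℝ) (y : Plane) : Plane :=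
  ∑ i, ∑ j, (ω i j * viewAngle (F.p i) (F.p j) y) • (F.p i - F.p j)

variable {ω : V → V → ℝ}

/-- By the equilibrium condition, the angle sum is locally constant off the framework. -/
lemma eventually_stressAngleSum_eq (hω : F.IsSelfStress ω) {x : Plane} (hx : x ∈ F.carrierᶜ) :
    ∀ᶠ y in 𝓝 x, F.stressAngleSum ω y = F.stressAngleSum ω x := by
  have key : ∀ᶠ y in 𝓝 x, ∀ i j, F.graph.Adj i j →
      viewAngle (F.p i) (F.p j) y - viewAngle (F.p i) (F.p j) x =
        turnAngle (F.p j) x y - turnAngle (F.p i) x y := by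
    simp only [eventually_all]
    intro i j h
    exact eventually_viewAngle_sub fun hs => hx (F.edge_subset_carrier h hs)
  filter_upwards [key] with y hy
  rw [← sub_eq_zero]
  -- By symmetry of `ω` each turning angle multiplies a term of the equilibrium sum at its own
  -- vertex; swapping the order of summation then kills both halves.
  have h1 : ∀ i j, (ω i j * viewAngle (F.p i) (F.p j) y) • (F.p i - F.p j) -
      (ω i j * viewAngle (F.p i) (F.p j) x) • (F.p i - F.p j) =
      -(turnAngle (F.p j) x y • ω j i • (F.p j - F.p i)) -
        turnAngle (F.p i) x y • ω i j • (F.p i - F.p j) := by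
    intro i j
    by_cases hij : F.graph.Adj i j
    · have e : viewAngle (F.p i) (F.p j) y = viewAngle (F.p i) (F.p j) x +
        (turnAngle (F.p j) x y - turnAngle (F.p i) x y) := by rw [← hy i j hij]; ring
      rw [e, hω.symm j i]
      module
    · rw [hω.symm j i, hω.eq_zero_of_not_adj i j hij]; simp
  simp only [stressAngleSum, ← Finset.sum_sub_distrib, h1]
  simp only [Finset.sum_sub_distrib]
  rw [Finset.sum_comm]
  simp only [Finset.sum_neg_distrib, ← Finset.smul_sum, hω.equilibrium]
  simp

lemma stressAngleSum_eq_of_mem_region (hω : F.IsSelfStress ω) {C : F.Chamber} {x y : Plane}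
    (hx : x ∈ C.region) (hy : y ∈ C.region) :
    F.stressAngleSum ω x = F.stressAngleSum ω y := by
  have hlc : IsLocallyConstant (fun z : ↥(F.carrierᶜ) => F.stressAngleSum ω z) := by
    rw [IsLocallyConstant.iff_eventually_eq]
    intro z
    exact continuous_subtype_val.continuousAt.eventually (eventually_stressAngleSum_eq hω z.2)
  obtain ⟨h, rfl⟩ := Chamber.mem_region.1 hx
  obtain ⟨h', e⟩ := Chamber.mem_region.1 hy
  rw [ConnectedComponents.coe_eq_coe'] at e
  exact (hlc.apply_eq_of_isPreconnected isPreconnected_connectedComponent e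
    mem_connectedComponent).symm

lemma tendsto_stressAngleSum_cobounded :
    Tendsto (F.stressAngleSum ω) (Bornology.cobounded Plane) (𝓝 0) := by
  have : Tendsto (F.stressAngleSum ω) (Bornology.cobounded Plane)
      (𝓝 (∑ i, ∑ j, (ω i j * 0) • (F.p i - F.p j))) :=
    tendsto_finsetSum _ fun i _ => tendsto_finsetSum _ fun j _ =>
      ((tendsto_viewAngle_cobounded _ _).const_mul _).smul_const _
  simpa using this

/-- An unbounded chamber has points arbitrarily far away, where the sum is close to 0, and the sum
is constant on the chamber. -/
lemma stressAngleSum_eq_zero (hω : F.IsSelfStress ω) {C : F.Chamber}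
    (hC : ¬ Bornology.IsBounded C.region) {x : Plane} (hx : x ∈ C.region) :
    F.stressAngleSum ω x = 0 := by
  have hfr : ∃ᶠ y in Bornology.cobounded Plane, y ∈ C.region := by
    rwa [Bornology.isBounded_def, ← Filter.eventually_mem_set] at hC
  by_contra hne
  obtain ⟨y, hy, hy'⟩ := (hfr.and_eventually
    ((tendsto_stressAngleSum_cobounded (F := F) (ω := ω)).eventually_ne (Ne.symm hne))).exists
  exact hy' (stressAngleSum_eq_of_mem_region hω hy hx)

/-- Crossing an edge at a point which lies on no other edge. -/
lemma tendsto_stressAngleSum_jump (hω : F.IsSelfStress ω) {i j : V} (hij : F.graph.Adj i j)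
    {x n : Plane} (hx : x ∈ openSegment ℝ (F.p i) (F.p j)) (hS : x ∉ F.crossings)
    (hn : planeDet n (F.p i - F.p j) ≠ 0) :
    Tendsto (fun t : ℝ => F.stressAngleSum ω (x + t • n) - F.stressAngleSum ω (x - t • n))
      (𝓝[>] 0) (𝓝 ((4 * Real.pi * (Real.sign (planeDet n (F.p i - F.p j)) * ω i j)) •
        (F.p i - F.p j))) := by
  classical
  set s := Real.sign (planeDet n (F.p i - F.p j))
  have hplus : Tendsto (fun t : ℝ => x + t • n) (𝓝[>] 0) (𝓝 x) := by
    have : ContinuousAt (fun t : ℝ => x + t • n) 0 := by fun_prop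
    simpa using this.tendsto.mono_left nhdsWithin_le_nhds
  have hminus : Tendsto (fun t : ℝ => x - t • n) (𝓝[>] 0) (𝓝 x) := by
    have : ContinuousAt (fun t : ℝ => x - t • n) 0 := by fun_prop
    simpa using this.tendsto.mono_left nhdsWithin_le_nhds
  have hne : i ≠ j := hij.ne
  -- Only the ordered pairs (i, j) and (j, i) jump, and equally: reversing the edge changes both the
  -- sign of the determinant and the edge vector.
  have hterm : ∀ k l, Tendsto (fun t : ℝ =>
      (ω k l * viewAngle (F.p k) (F.p l) (x + t • n)) • (F.p k - F.p l) -
      (ω k l * viewAngle (F.p k) (F.p l) (x - t • n)) • (F.p k - F.p l)) (𝓝[>] 0)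
      (𝓝 ((if k = i ∧ l = j then (2 * Real.pi * (s * ω i j)) • (F.p i - F.p j) else 0) +
        (if k = j ∧ l = i then (2 * Real.pi * (s * ω i j)) • (F.p i - F.p j) else 0))) := by
    intro k l
    simp only [← sub_smul, ← mul_sub]
    by_cases h1 : k = i ∧ l = j
    · obtain ⟨rfl, rfl⟩ := h1
      have h2 : ¬ (k = l ∧ l = k) := fun h => hne h.1
      rw [if_pos ⟨rfl, rfl⟩, if_neg h2, add_zero]
      convert ((tendsto_viewAngle_jump (F.injective_p.ne hne) hx hn).const_mul
        (ω k l)).smul_const (F.p k - F.p l) using 2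
      congr 1; ring
    by_cases h2 : k = j ∧ l = i
    · obtain ⟨rfl, rfl⟩ := h2
      rw [if_neg h1, if_pos ⟨rfl, rfl⟩, zero_add]
      have hd : planeDet n (F.p k - F.p l) = -planeDet n (F.p l - F.p k) := by
        simp [planeDet, Matrix.det_fin_two]; ring
      rw [openSegment_symm] at hx
      convert ((tendsto_viewAngle_jump (F.injective_p.ne hne.symm) hx
        (by rw [hd]; exact neg_ne_zero.2 hn)).const_mul (ω k l)).smul_const (F.p k - F.p l) using 2
      rw [hd, Real.sign_neg, hω.symm l k]
      module
    rw [if_neg h1, if_neg h2, add_zero]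
    by_cases hkl : F.graph.Adj k l
    · have hns : x ∉ segment ℝ (F.p k) (F.p l) := by
        intro hkx
        refine hS (Or.inr ⟨i, j, k, l, hij, hkl, ?_, openSegment_subset_segment _ _ _ hx, hkx⟩)
        rw [Ne, Sym2.eq_iff]
        rintro (⟨rfl, rfl⟩ | ⟨rfl, rfl⟩)
        exacts [h1 ⟨rfl, rfl⟩, h2 ⟨rfl, rfl⟩]
      have hc := (continuousAt_viewAngle hns).tendsto
      simpa using (((hc.comp hplus).sub (hc.comp hminus)).const_mul (ω k l)).smul_const
        (F.p k - F.p l)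
    · simp [hω.eq_zero_of_not_adj k l hkl]
  have hsum := tendsto_finsetSum Finset.univ fun k _ =>
    tendsto_finsetSum Finset.univ fun l _ => hterm k l
  simp only [Finset.sum_sub_distrib] at hsum
  have hlim : ∑ k, ∑ l,
      ((if k = i ∧ l = j then (2 * Real.pi * (s * ω i j)) • (F.p i - F.p j) else 0) +
        (if k = j ∧ l = i then (2 * Real.pi * (s * ω i j)) • (F.p i - F.p j) else 0)) =
      (4 * Real.pi * (s * ω i j)) • (F.p i - F.p j) := by
    simp only [Finset.sum_add_distrib, ite_and, Finset.sum_ite_irrel, Finset.sum_ite_eq',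
      Finset.sum_const_zero, Finset.mem_univ, if_true]
    module
  rwa [hlim] at hsum

end Stress

/-! ### Existence of the lifting. -/

lemma planeDet_ne_zero_of_inner_eq_zero {n v : Plane} (hn : ‖n‖ = 1) (hv : v ≠ 0)
    (h : inner ℝ n v = 0) : planeDet n v ≠ 0 := by
  -- The inner product and the determinant are the coordinates of `v` in the orthonormal basis
  -- formed by `n` and its quarter turn.
  intro hd
  have h1 : n 0 * v 0 + n 1 * v 1 = 0 := by
    simp [PiLp.inner_apply, Fin.sum_univ_two] at h; linarith
  have h2 : n 0 * v 1 - v 0 * n 1 = 0 := by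
    simpa [planeDet, Matrix.det_fin_two] using hd
  have h3 : n 0 ^ 2 + n 1 ^ 2 = 1 := by
    have := EuclideanSpace.norm_sq_eq n
    simp [hn, Fin.sum_univ_two] at this; linarith
  apply hv
  ext k
  fin_cases k
  · simp
    linear_combination (-v 0) * h3 + n 0 * h1 - n 1 * h2
  · simp
    linear_combination (-v 1) * h3 + n 1 * h1 + n 0 * h2

/-- `formOf` as a linear map. -/
def formOfLinear : Plane →ₗ[ℝ] ConstOneForm where
  toFun := formOf
  map_add' u v := by simp [formOf]; module
  map_smul' c v := by simp [formOf]; module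

lemma infinite_openSegment {a b : Plane} (h : a ≠ b) : (openSegment ℝ a b).Infinite := by
  rw [openSegment_eq_image_lineMap]
  exact (Ioo_infinite one_pos).image (AffineMap.lineMap_injective ℝ h).injOn

variable [Fintype V] {ω : V → V → ℝ}

lemma exists_isDifferentialLifting (hF : F.EdgesDoNotOverlap) (hω : F.IsSelfStress ω) :
    ∃ l : F.Chamber → ConstOneForm, F.IsDifferentialLifting ω l := by
  refine ⟨fun C => formOfLinear ((4 * Real.pi)⁻¹ • F.stressAngleSum ω C.region_nonempty.some),
    ⟨fun C₁ C₂ i j a b n hN hn => ?_, fun C hC => ?_⟩⟩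
  -- The shared sub-segment is infinite, so it has a point lying on no other edge, at which the jump
  -- can be read off.
  · obtain ⟨x, hx, hxS⟩ := (infinite_openSegment hN.endpoints_ne).exists_notMem_finite
      (finite_crossings hF)
    have hd : planeDet n (F.p i - F.p j) ≠ 0 := planeDet_ne_zero_of_inner_eq_zero hn.norm_eq_one
      (sub_ne_zero.2 (F.injective_p.ne hN.adj.ne)) hn.orthogonal
    have hlim := tendsto_stressAngleSum_jump hω hN.adj (hN.subset_edge hx) hxS hd
    have hconst : Tendsto (fun t : ℝ => F.stressAngleSum ω (x + t • n) -
        F.stressAngleSum ω (x - t • n)) (𝓝[>] 0) (𝓝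
        (F.stressAngleSum ω C₂.region_nonempty.some -
          F.stressAngleSum ω C₁.region_nonempty.some)) := by
      refine tendsto_const_nhds.congr' ?_
      filter_upwards [hn.crosses x hx] with t ht
      rw [stressAngleSum_eq_of_mem_region hω ht.1 C₁.region_nonempty.some_mem,
        stressAngleSum_eq_of_mem_region hω ht.2 C₂.region_nonempty.some_mem]
    have e := tendsto_nhds_unique hconst hlim
    unfold NeighbouringCondition
    rw [← map_sub, ← smul_sub, e, smul_smul, ← mul_assoc, inv_mul_cancel₀ (by positivity),
      one_mul, map_smul]
    rfl
  · simp only [stressAngleSum_eq_zero hω hC C.region_nonempty.some_mem, smul_zero, map_zero]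

end PlaneFramework

/-! ### Half-balls on the two sides of an edge. -/

/-- The open half of a ball on the side of its centre to which `n` points. -/
def halfBall (z : Plane) (r : ℝ) (n : Plane) : Set Plane :=
  Metric.ball z r ∩ {y | 0 < inner ℝ n (y - z)}

lemma convex_halfBall (z : Plane) (r : ℝ) (n : Plane) : Convex ℝ (halfBall z r n) := by
  refine (convex_ball z r).inter ?_
  have : {y : Plane | 0 < inner ℝ n (y - z)} = {y | inner ℝ n z < innerSL ℝ n y} := by
    ext y; simp [inner_sub_right]
  rw [this]
  exact convex_halfSpace_gt (innerSL ℝ n).toLinearMap.isLinear _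

lemma eventually_mem_halfBall {z x n : Plane} {r : ℝ} (hn : ‖n‖ = 1) (hx : x ∈ Metric.ball z r)
    (h0 : inner ℝ n (x - z) = 0) : ∀ᶠ t : ℝ in 𝓝[>] 0, x + t • n ∈ halfBall z r n := by
  have hplus : Tendsto (fun t : ℝ => x + t • n) (𝓝[>] 0) (𝓝 x) := by
    have : ContinuousAt (fun t : ℝ => x + t • n) 0 := by fun_prop
    simpa using this.tendsto.mono_left nhdsWithin_le_nhds
  filter_upwards [hplus (Metric.isOpen_ball.mem_nhds hx), self_mem_nhdsWithin] with t h1 h2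
  refine ⟨h1, ?_⟩
  have e : x + t • n - z = (x - z) + t • n := by abel
  change 0 < inner ℝ n (x + t • n - z)
  rw [e, inner_add_right, h0, inner_smul_right, real_inner_self_eq_norm_sq, hn]
  simpa using h2

lemma mem_closure_halfBall {z x n : Plane} {r : ℝ} (hn : ‖n‖ = 1) (hx : x ∈ Metric.ball z r)
    (h0 : inner ℝ n (x - z) = 0) : x ∈ closure (halfBall z r n) := by
  have hplus : Tendsto (fun t : ℝ => x + t • n) (𝓝[>] 0) (𝓝 x) := by
    have : ContinuousAt (fun t : ℝ => x + t • n) 0 := by fun_prop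
    simpa using this.tendsto.mono_left nhdsWithin_le_nhds
  exact mem_closure_of_tendsto hplus (eventually_mem_halfBall hn hx h0)

/-- The witness is `v` turned by a quarter and normalised. The last clause recovers points of the
edge's line from the vanishing of their normal coordinate. -/
lemma exists_unit_normal {v : Plane} (hv : v ≠ 0) :
    ∃ n : Plane, ‖n‖ = 1 ∧ inner ℝ n v = 0 ∧
      ∀ w : Plane, inner ℝ n w = 0 → w = (inner ℝ v w / ‖v‖ ^ 2) • v := by
  have hv' : ‖v‖ ≠ 0 := norm_ne_zero_iff.2 hv
  have hsq : ‖v‖ ^ 2 = v 0 ^ 2 + v 1 ^ 2 := by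
    rw [EuclideanSpace.norm_sq_eq]; simp [Fin.sum_univ_two]
  refine ⟨‖v‖⁻¹ • !₂[-v 1, v 0], ?_, ?_, fun w hw => ?_⟩
  · have : ‖(!₂[-v 1, v 0] : Plane)‖ = ‖v‖ := by
      simp [EuclideanSpace.norm_eq, Fin.sum_univ_two, add_comm]
    rw [norm_smul, this, norm_inv, norm_norm, inv_mul_cancel₀ hv']
  · rw [inner_smul_left]
    simp [PiLp.inner_apply, Fin.sum_univ_two]
    right; ring
  · have h1 : v 0 * w 1 = v 1 * w 0 := by
      rw [inner_smul_left] at hw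
      simp [PiLp.inner_apply, Fin.sum_univ_two, hv] at hw
      linarith
    have h2 : inner ℝ v w = v 0 * w 0 + v 1 * w 1 := by
      simp [PiLp.inner_apply, Fin.sum_univ_two]; ring
    have h3 : v 0 ^ 2 + v 1 ^ 2 ≠ 0 := by rw [← hsq]; positivity
    rw [h2, hsq]
    ext k
    fin_cases k
    · simp
      field_simp
      linear_combination (-v 1) * h1
    · simp
      field_simp
      linear_combination (v 0) * h1

/-! ### Uniqueness: functions agreeing on neighbours are constant. -/

namespace PlaneFramework

variable {V : Type*} {F : PlaneFramework V}

/-- Near a point which is neither a vertex nor a crossing, the framework is a single edge. -/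
lemma eventually_mem_segment_of_mem_carrier [Finite V] {i j : V} (hij : F.graph.Adj i j)
    {z : Plane} (hz : z ∈ segment ℝ (F.p i) (F.p j)) (hS : z ∉ F.crossings) :
    ∀ᶠ y in 𝓝 z, y ∈ F.carrier → y ∈ segment ℝ (F.p i) (F.p j) := by
  have hv : ∀ᶠ y in 𝓝 z, ∀ k, y ≠ F.p k :=
    eventually_all.2 fun k => isOpen_ne.mem_nhds fun h => hS (Or.inl ⟨k, h.symm⟩)
  have he : ∀ᶠ y in 𝓝 z, ∀ k l, F.graph.Adj k l → s(i, j) ≠ s(k, l) →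
      y ∉ segment ℝ (F.p k) (F.p l) := by
    simp only [eventually_all]
    intro k l hkl hne
    exact (isCompact_plane_segment _ _).isClosed.isOpen_compl.mem_nhds
      fun h => hS (Or.inr ⟨i, j, k, l, hij, hkl, hne, hz, h⟩)
  filter_upwards [hv, he] with y h1 h2 hy
  rcases hy with ⟨k, hk⟩ | ⟨k, l, hkl, hy⟩
  · exact absurd hk.symm (h1 k)
  · by_cases h : s(i, j) = s(k, l)
    · rcases Sym2.eq_iff.1 h with ⟨rfl, rfl⟩ | ⟨rfl, rfl⟩
      · exact hy
      · rwa [segment_symm]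
    · exact absurd hy (h2 k l hkl h)

lemma eventually_add_smul_mem_openSegment {p q z : Plane} (hz : z ∈ openSegment ℝ p q) :
    ∀ᶠ s : ℝ in 𝓝 0, z + s • (p - q) ∈ openSegment ℝ p q := by
  obtain ⟨a, b, ha, hb, hab, rfl⟩ := hz
  filter_upwards [Ioo_mem_nhds (neg_lt_zero.2 ha) hb] with s hs
  exact ⟨a + s, b - s, by linarith [hs.1], by linarith [hs.2], by linarith, by module⟩

/-- A function on the chambers agreeing on neighbours is constant near every point that is
neither a vertex nor a crossing, and such a point is in the closure of the complement. -/
lemma exists_eventually_eq_const [Finite V] {E : Type*} {m : F.Chamber → E}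
    (hm : ∀ (C₁ C₂ : F.Chamber) (i j : V) (a b n : Plane),
      AreNeighboursAlong C₁ C₂ i j a b → IsUnitNormalFromTo n C₁ C₂ i j a b → m C₁ = m C₂)
    {z : Plane} (hS : z ∉ F.crossings) :
    z ∈ closure F.carrierᶜ ∧ ∃ c, ∀ᶠ y in 𝓝 z, ∀ C : F.Chamber, y ∈ C.region → m C = c := by
  by_cases hzG : z ∈ F.carrierᶜ
  · refine ⟨subset_closure hzG, ?_⟩
    obtain ⟨C, hC⟩ := Chamber.exists_mem_region hzG
    obtain ⟨r, hr, hsub⟩ := Metric.isOpen_iff.1 F.isCompact_carrier.isClosed.isOpen_compl z hzG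
    have hball := Chamber.subset_region_of_isPreconnected (convex_ball z r).isPreconnected hsub
      (Metric.mem_ball_self hr) hC
    refine ⟨m C, ?_⟩
    filter_upwards [Metric.ball_mem_nhds z hr] with y hy D hD
    rw [Chamber.eq_of_mem_region hD (hball hy)]
  rw [mem_compl_iff, not_not] at hzG
  obtain ⟨i, j, hij, hz⟩ : ∃ i j, F.graph.Adj i j ∧ z ∈ segment ℝ (F.p i) (F.p j) :=
    hzG.resolve_left fun h => hS (Or.inl h)
  have hzo := mem_openSegment_of_notMem_crossings hz hS
  set v := F.p i - F.p j with hvdef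
  have hv : v ≠ 0 := sub_ne_zero.2 (F.injective_p.ne hij.ne)
  obtain ⟨n, hn, hnv, hpar⟩ := exists_unit_normal hv
  have hline : ∀ y ∈ segment ℝ (F.p i) (F.p j), inner ℝ n (y - z) = 0 := by
    rintro y ⟨a, b, -, -, hab, rfl⟩
    obtain ⟨a', b', -, -, hab', rfl⟩ := hz
    have e : a • F.p i + b • F.p j - (a' • F.p i + b' • F.p j) = (a - a') • v := by
      obtain rfl : b = 1 - a := by linarith
      obtain rfl : b' = 1 - a' := by linarith
      rw [hvdef]; module
    rw [e, inner_smul_right, hnv, mul_zero]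
  -- Together with `hline` this makes the framework, in a small ball about `z`, exactly a diameter.
  -- Both open half-balls then avoid it and, being convex, lie in one chamber each.
  have hon : ∀ᶠ y in 𝓝 z, inner ℝ n (y - z) = 0 → y ∈ F.carrier := by
    have hc : ContinuousAt (fun y : Plane => inner ℝ v (y - z) / ‖v‖ ^ 2) z := by fun_prop
    have ht : Tendsto (fun y : Plane => inner ℝ v (y - z) / ‖v‖ ^ 2) (𝓝 z) (𝓝 0) := by
      simpa [ContinuousAt] using hc
    filter_upwards [ht.eventually (eventually_add_smul_mem_openSegment hzo)] with y hy h0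
    rw [← hvdef, ← hpar _ h0, add_sub_cancel] at hy
    exact F.edge_subset_carrier hij (openSegment_subset_segment _ _ _ hy)
  obtain ⟨r, hr, hball⟩ := Metric.eventually_nhds_iff_ball.1
    ((eventually_mem_segment_of_mem_carrier hij hz hS).and hon)
  have hhalf : ∀ n' : Plane, (∀ y, inner ℝ n (y - z) = 0 → inner ℝ n' (y - z) = 0) →
      halfBall z r n' ⊆ F.carrierᶜ := fun n' hn' y hy hyG =>
    hy.2.ne' (hn' y (hline y ((hball y hy.1).1 hyG)))
  have hpos := hhalf n fun _ h => h
  have hneg := hhalf (-n) fun _ h => by rw [inner_neg_left, h, neg_zero]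
  have hn' : ‖-n‖ = 1 := by rw [norm_neg, hn]
  have hzball := Metric.mem_ball_self (x := z) hr
  have hz0 : inner ℝ n (z - z) = 0 := by simp
  refine ⟨closure_mono hpos (mem_closure_halfBall hn hzball hz0), ?_⟩
  obtain ⟨t, ht1, ht2⟩ := ((eventually_mem_halfBall hn hzball hz0).and
    (eventually_mem_halfBall hn' hzball (by simp))).exists
  obtain ⟨C₂, hC₂⟩ := Chamber.exists_mem_region (hpos ht1)
  obtain ⟨C₁, hC₁⟩ := Chamber.exists_mem_region (hneg ht2)
  have hsub₂ := Chamber.subset_region_of_isPreconnected (convex_halfBall z r n).isPreconnected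
    hpos ht1 hC₂
  have hsub₁ := Chamber.subset_region_of_isPreconnected (convex_halfBall z r (-n)).isPreconnected
    hneg ht2 hC₁
  have hmm : m C₁ = m C₂ := by
    by_cases hne : C₁ = C₂
    · rw [hne]
    have hevent : ∀ᶠ s : ℝ in 𝓝 0, z + s • v ∈ openSegment ℝ (F.p i) (F.p j) ∩ Metric.ball z r := by
      refine (eventually_add_smul_mem_openSegment hzo).and ?_
      have : ContinuousAt (fun s : ℝ => z + s • v) 0 := by fun_prop
      exact this.eventually_mem (Metric.isOpen_ball.mem_nhds (by simpa using hr))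
    -- If the two chambers differ, the sub-segment between z ± (δ/2) v shows that they are
    -- neighbours.
    obtain ⟨δ, hδ, hδs⟩ := Metric.eventually_nhds_iff_ball.1 hevent
    have ha := hδs (δ / 2) (by simp [abs_of_pos hδ, hδ])
    have hb := hδs (-(δ / 2)) (by simp [abs_of_pos hδ, hδ])
    have hab := ((convex_openSegment (F.p i) (F.p j)).inter
      (convex_ball z r)).openSegment_subset ha hb
    have hcarrier : ∀ x ∈ openSegment ℝ (z + (δ / 2) • v) (z + (-(δ / 2)) • v), x ∈ F.carrier :=
      fun x hx => F.edge_subset_carrier hij (openSegment_subset_segment _ _ _ (hab hx).1)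
    have hx0 : ∀ x ∈ openSegment ℝ (z + (δ / 2) • v) (z + (-(δ / 2)) • v),
        inner ℝ n (x - z) = 0 := fun x hx => hline x (openSegment_subset_segment _ _ _ (hab hx).1)
    have hx0' : ∀ x ∈ openSegment ℝ (z + (δ / 2) • v) (z + (-(δ / 2)) • v),
        inner ℝ (-n) (x - z) = 0 := fun x hx => by rw [inner_neg_left, hx0 x hx, neg_zero]
    refine hm C₁ C₂ i j (z + (δ / 2) • v) (z + (-(δ / 2)) • v) n
      ⟨hne, hij, fun h => ?_, fun x hx => (hab hx).1, fun x hx => ?_, fun x hx => ?_⟩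
      ⟨hn, hnv, fun x hx => ?_⟩
    · have h1 : δ • v = 0 := by
        have h2 := sub_eq_zero.2 h
        rw [← h2]; module
      exact (smul_ne_zero hδ.ne' hv) h1
    -- The point is a limit of the half-ball, but not interior to the chamber since it lies on the
    -- framework.
    · exact ⟨closure_mono hsub₁ (mem_closure_halfBall hn' (hab hx).2 (hx0' x hx)),
        fun h => C₁.region_subset (interior_subset h) (hcarrier x hx)⟩
    · exact ⟨closure_mono hsub₂ (mem_closure_halfBall hn (hab hx).2 (hx0 x hx)),
        fun h => C₂.region_subset (interior_subset h) (hcarrier x hx)⟩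
    · filter_upwards [eventually_mem_halfBall hn (hab hx).2 (hx0 x hx),
        eventually_mem_halfBall hn' (hab hx).2 (hx0' x hx)] with t h2 h1
      refine ⟨hsub₁ ?_, hsub₂ h2⟩
      simpa [sub_eq_add_neg] using h1
  refine ⟨m C₂, ?_⟩
  filter_upwards [Metric.ball_mem_nhds z hr] with y hy C hC
  rcases lt_trichotomy (inner ℝ n (y - z)) 0 with h | h | h
  · have hy' : y ∈ halfBall z r (-n) := ⟨hy, by
      change 0 < inner ℝ (-n) (y - z); rw [inner_neg_left]; linarith⟩
    rw [Chamber.eq_of_mem_region hC (hsub₁ hy'), hmm]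
  · exact absurd ((hball y hy).2 h) (C.region_subset hC)
  · rw [Chamber.eq_of_mem_region hC (hsub₂ ⟨hy, h⟩)]

/-- A function on the chambers agreeing on neighbours is constant. -/
lemma eq_of_forall_neighbours [Finite V] (hF : F.EdgesDoNotOverlap) {E : Type*}
    {m : F.Chamber → E}
    (hm : ∀ (C₁ C₂ : F.Chamber) (i j : V) (a b n : Plane),
      AreNeighboursAlong C₁ C₂ i j a b → IsUnitNormalFromTo n C₁ C₂ i j a b → m C₁ = m C₂)
    (C D : F.Chamber) : m C = m D := by
  by_contra hne
  -- The sets for {m C} and for its complement are open, cover the plane minus the crossings, and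
  -- both meet it; connectedness makes them overlap there.
  let U : Set E → Set Plane := fun A =>
    {z | ∀ᶠ y in 𝓝 z, ∀ C : F.Chamber, y ∈ C.region → m C ∈ A}
  have hU : ∀ A, IsOpen (U A) := fun A => isOpen_iff_mem_nhds.2 fun z hz =>
    (eventually_eventually_nhds.2 hz : _)
  have hrank : 1 < Module.rank ℝ Plane := by
    rw [← Module.finrank_eq_rank]; simp
  have hconn : IsPreconnected F.crossingsᶜ :=
    ((finite_crossings hF).countable.isPathConnected_compl_of_one_lt_rank
      hrank).isConnected.isPreconnected
  have hself : ∀ (C : F.Chamber) (A : Set E), m C ∈ A → (F.crossingsᶜ ∩ U A).Nonempty := by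
    intro C A hA
    obtain ⟨x, hx⟩ := C.region_nonempty
    have hxG := C.region_subset hx
    have hxS : x ∉ F.crossings := by
      rintro (⟨i, rfl⟩ | ⟨i, j, -, -, hij, -, -, h, -⟩)
      exacts [hxG (F.vertex_mem_carrier i), hxG (F.edge_subset_carrier hij h)]
    obtain ⟨-, c, hc⟩ := exists_eventually_eq_const hm hxS
    refine ⟨x, hxS, ?_⟩
    have hcA : c ∈ A := hc.self_of_nhds C hx ▸ hA
    filter_upwards [hc] with y hy D hD
    rw [hy D hD]; exact hcA
  obtain ⟨z, hzS, h1, h2⟩ := hconn (U {m C}) (U {m C}ᶜ) (hU _) (hU _) (fun z hz => by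
      obtain ⟨-, c, hc⟩ := exists_eventually_eq_const hm hz
      by_cases h : c = m C
      · left; filter_upwards [hc] with y hy D hD
        rw [hy D hD]; exact h
      · right; filter_upwards [hc] with y hy D hD
        rw [hy D hD]; exact h)
    (hself C _ rfl) (hself D _ fun h => hne h.symm)
  -- The condition defining `U` is vacuous at points of the framework, so the contradiction needs a
  -- point off the framework near `z`.
  obtain ⟨hcl, -⟩ := exists_eventually_eq_const hm hzS
  obtain ⟨y, hyG, hy1, hy2⟩ := ((mem_closure_iff_frequently.1 hcl).and_eventually
    (Eventually.and h1 h2)).exists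
  obtain ⟨K, hK⟩ := Chamber.exists_mem_region hyG
  exact hy2 K hK (hy1 K hK)

variable (F) in
-- The framework is bounded, and a ray starting outside a disc around it lies in a single chamber.
lemma exists_unbounded_chamber [Finite V] :
    ∃ C : F.Chamber, ¬ Bornology.IsBounded C.region := by
  obtain ⟨R, hR⟩ := F.isCompact_carrier.isBounded.subset_closedBall (0 : Plane)
  set e : Plane := EuclideanSpace.single 0 1
  have he : ∀ t : ℝ, ‖t • e‖ = |t| := fun t => by simp [e, norm_smul]
  have hsub : (fun t : ℝ => t • e) '' Ioi |R| ⊆ F.carrierᶜ := by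
    rintro _ ⟨t, ht, rfl⟩ hG
    have h1 := hR hG
    simp only [mem_closedBall_zero_iff, he] at h1
    have h2 : |R| < t := ht
    linarith [le_abs_self R, le_abs_self t]
  have hpre : IsPreconnected ((fun t : ℝ => t • e) '' Ioi |R|) :=
    isPreconnected_Ioi.image _ (by fun_prop)
  have hmem : (|R| + 1) • e ∈ (fun t : ℝ => t • e) '' Ioi |R| :=
    mem_image_of_mem (fun t : ℝ => t • e) (by simp : |R| + 1 ∈ Ioi |R|)
  obtain ⟨C, hC⟩ := Chamber.exists_mem_region (hsub hmem)
  refine ⟨C, fun hb => ?_⟩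
  obtain ⟨M, hM⟩ := (hb.subset
    (Chamber.subset_region_of_isPreconnected hpre hsub hmem hC)).exists_norm_le
  have := hM _ (mem_image_of_mem _ (by
    rw [mem_Ioi]; linarith [abs_nonneg M] : |R| + |M| + 1 ∈ Ioi |R|))
  rw [he] at this
  linarith [le_abs_self M, le_abs_self (|R| + |M| + 1), abs_nonneg R]

end PlaneFramework

end

theorem theorem2 {V : Type*} [Fintype V] (F : PlaneFramework V) (hF : F.EdgesDoNotOverlap)
    (ω : V → V → ℝ) (hω : F.IsSelfStress ω) :
    ∃! l : F.Chamber → ConstOneForm, F.IsDifferentialLifting ω l := by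
  obtain ⟨l, hl⟩ := PlaneFramework.exists_isDifferentialLifting hF hω
  refine ⟨l, hl, fun l' hl' => funext fun C => ?_⟩
  obtain ⟨D, hD⟩ := F.exists_unbounded_chamber
  -- Both liftings have the same prescribed jumps, so these cancel in the difference.
  have h := PlaneFramework.eq_of_forall_neighbours hF (m := fun C => l' C - l C)
    (fun C₁ C₂ i j a b n hN hn => by
      have h1 := hl.neighbouring C₁ C₂ i j a b n hN hn
      have h2 := hl'.neighbouring C₁ C₂ i j a b n hN hn
      unfold PlaneFramework.NeighbouringCondition at h1 h2
      rw [← h1] at h2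
      rw [sub_eq_sub_iff_add_eq_add] at h2 ⊢
      rw [add_comm, ← h2, add_comm]) C D
  simp only [hl.unbounded D hD, hl'.unbounded D hD, sub_zero] at h
  exact sub_eq_zero.1 h
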